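/- For a real number $x$ let $\Vert x\Vert$ denote the distance from $x$ to the nearest integer. A Pisot number is a real algebraic integer $\zeta>1$ all of whose conjugates over $\mathbb{Q}$ other than $\zeta$ itself have absolute value strictly less than $1$; let $S$ be the set of all Pisot numbers. For $\zeta\in S$ put $$\mathscr{M}_{\zeta}=\{\alpha\in\mathbb{R} : \lim_{n\to\infty}\Vert \alpha\zeta^{n}\Vert=0\}.$$ Let $K\subset\mathbb{R}$ be a real number field (a subfield of $\mathbb{R}$ of finite degree over $\mathbb{Q}$) with $K\neq\mathbb{Q}$, let $\mathcal{O}_K$ be its ring of integers, and let $S_K=\{\zeta\in S : \mathbb{Q}(\zeta)=K\}$. Then $$\bigcap_{\zeta\in S\cap K}\mathscr{M}_{\zeta}=\mathbb{Z}\subsetneq\mathcal{O}_K\subseteq\bigcap_{\zeta\in S_K}\mathscr{M}_{\zeta}\subsetneq\bigcup_{\zeta\in S_K}\mathscr{M}_{\zeta}=\bigcup_{\zeta\in S\cap K}\mathscr{M}_{\zeta}=K.$$ -/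

import Mathlib

open Filter Topology

noncomputable section

namespace PisotModules

/-- The distance `|x - ⟨x⟩|` from a real number to its nearest integer `⟨x⟩ = ⌊x + 1/2⌋`
(this is `round x`, see `round_eq`). -/
def distInt (x : ℝ) : ℝ := |x - (round x : ℝ)|

/-- A Pisot number: a real algebraic integer `ζ > 1` all of whose complex conjugates
other than `ζ` itself lie strictly inside the unit circle. -/
def IsPisot (ζ : ℝ) : Prop :=
  IsIntegral ℤ ζ ∧ 1 < ζ ∧
    ∀ z : ℂ, Polynomial.aeval z (minpoly ℚ ζ) = 0 → z ≠ (ζ : ℂ) → ‖z‖ < 1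

/-- The set `S ∩ K` of Pisot numbers lying in `K`. -/
def pisotIn (K : IntermediateField ℚ ℝ) : Set ℝ := {ζ | IsPisot ζ ∧ ζ ∈ K}

/-- The set `S_K` of Pisot numbers generating `K`, i.e. with `ℚ(ζ) = K`. -/
def pisotGen (K : IntermediateField ℚ ℝ) : Set ℝ :=
  {ζ | IsPisot ζ ∧ IntermediateField.adjoin ℚ {ζ} = K}

/-- The set `M_ζ` of real `α` such that the distance from `α ζ ^ n` to the nearest integer
tends to `0`. -/
def M (ζ : ℝ) : Set ℝ := {α | Tendsto (fun n : ℕ => distInt (α * ζ ^ n)) atTop (𝓝 0)}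

/-- The rational integers, as a set of real numbers. -/
def intSet : Set ℝ := Set.range ((↑) : ℤ → ℝ)

/-- The ring of integers of the real field `K`, as a set of real numbers. -/
def ringOfIntegersSet (K : IntermediateField ℚ ℝ) : Set ℝ :=
  Set.range (fun x : NumberField.RingOfIntegers K => ((x : K) : ℝ))

end PisotModules

end

open Filter Topology Polynomial

namespace PisotModules

/-! Write `α ζ ^ n = a n + e n` with `a n` the nearest integer and `e n → 0`. The minimal polynomial
`P` of `ζ`, acting as a recurrence, kills `α ζ ^ n`, so it sends `a` to an integer sequence tending
to 0, hence eventually 0. Factoring `P = Q (X - ζ)` then gives `α P'(ζ) ζ ^ N ∈ ℤ[ζ]`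
(`exists_mul_derivative_mul_pow_mem_adjoin`). So `M ζ` lies in `ℚ(ζ)` and misses some rational, and
`M 2 ∩ M 3 ⊆ ℤ`.

Conversely, for integral `α ∈ ℚ(ζ)` the integer `Tr(α ζ ^ n)` differs from `α ζ ^ n` by conjugate
terms tending to 0 (`mem_M_of_isIntegral`). Minkowski's theorem gives Pisot generators of `K`
divisible by any `d > 0`; such a generator clears the denominator `d` of an element of `K`, so the
union is all of `K`. -/

/-! ### Recurrences and the upper bound on `M ζ` -/

/-- The shift operator `(f n) ↦ (f (n + 1))` on real sequences. -/
noncomputable def shift : Module.End ℝ (ℕ → ℝ) := LinearMap.funLeft ℝ ℝ Nat.succ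

lemma shift_apply (f : ℕ → ℝ) (n : ℕ) : shift f n = f (n + 1) := rfl

lemma shift_pow_apply (i : ℕ) (f : ℕ → ℝ) (n : ℕ) : (shift ^ i) f n = f (n + i) := by
  induction i generalizing n with
  | zero => simp
  | succ i ih =>
    rw [pow_succ', Module.End.mul_apply, shift_apply, ih]
    congr 1
    omega

lemma aeval_shift_apply (p : ℝ[X]) (f : ℕ → ℝ) (n : ℕ) :
    aeval shift p f n = ∑ i ∈ Finset.range (p.natDegree + 1), p.coeff i * f (n + i) := by
  rw [aeval_eq_sum_range, LinearMap.sum_apply, Finset.sum_apply]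
  simp [shift_pow_apply]

lemma aeval_shift_mem {A : Subring ℝ} {p : ℝ[X]} (hp : ∀ i, p.coeff i ∈ A) {f : ℕ → ℝ}
    (hf : ∀ n, f n ∈ A) (n : ℕ) : aeval shift p f n ∈ A := by
  rw [aeval_shift_apply]
  exact sum_mem fun i _ => mul_mem (hp i) (hf _)

lemma tendsto_aeval_shift (p : ℝ[X]) {f : ℕ → ℝ} (hf : Tendsto f atTop (𝓝 0)) :
    Tendsto (aeval shift p f) atTop (𝓝 0) := by
  have : aeval shift p f =
      fun n => ∑ i ∈ Finset.range (p.natDegree + 1), p.coeff i * f (n + i) :=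
    funext (aeval_shift_apply p f)
  rw [this]
  have h : Tendsto (fun n => ∑ i ∈ Finset.range (p.natDegree + 1), p.coeff i * f (n + i)) atTop
      (𝓝 (∑ i ∈ Finset.range (p.natDegree + 1), p.coeff i * 0)) :=
    tendsto_finsetSum _ fun i _ => ((tendsto_add_atTop_iff_nat i).2 hf).const_mul _
  simpa using h

lemma aeval_shift_geom (p : ℝ[X]) (α ζ : ℝ) (n : ℕ) :
    aeval shift p (fun n => α * ζ ^ n) n = α * p.eval ζ * ζ ^ n := by
  rw [aeval_shift_apply, eval_eq_sum_range, Finset.mul_sum, Finset.sum_mul]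
  exact Finset.sum_congr rfl fun i _ => by ring

/-- A sequence of integers tending to zero is eventually zero. -/
lemma eventually_eq_zero_of_tendsto {f : ℕ → ℝ} (hf : Tendsto f atTop (𝓝 0))
    (hint : ∀ n, f n ∈ (Int.castRingHom ℝ).range) : ∃ N, ∀ n, N ≤ n → f n = 0 := by
  obtain ⟨N, hN⟩ := eventually_atTop.1 (hf.eventually (Metric.ball_mem_nhds 0 one_pos))
  refine ⟨N, fun n hn => ?_⟩
  obtain ⟨k, hk⟩ := hint n
  have h := hN n hn
  rw [dist_zero_right, ← hk, Real.norm_eq_abs, eq_intCast] at h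
  have : |k| < 1 := by exact_mod_cast h
  rw [← hk, Int.abs_lt_one_iff.1 this]
  simp

/-- If `‖α ζ ^ n‖ → 0`, then `α` lies in `ℤ[ζ]` up to the derivative of the minimal polynomial at
`ζ` and a power of `ζ`. -/
theorem exists_mul_derivative_mul_pow_mem_adjoin {ζ α : ℝ} (h1 : 1 < ζ) (hα : α ∈ M ζ) :
    ∃ N : ℕ, α * aeval ζ (derivative (minpoly ℤ ζ)) * ζ ^ N ∈ Algebra.adjoin ℤ {ζ} := by
  set P : ℝ[X] := (minpoly ℤ ζ).map (algebraMap ℤ ℝ) with hP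
  set Q : ℝ[X] := minpolyDiv ℤ ζ with hQ
  have hPQ : Q * (X - C ζ) = P := minpolyDiv_spec ℤ ζ
  set g : ℕ → ℝ := fun n => α * ζ ^ n with hg
  set a : ℕ → ℝ := fun n => (round (α * ζ ^ n) : ℝ) with ha
  have he : Tendsto (g - a) atTop (𝓝 0) := by
    rw [tendsto_zero_iff_abs_tendsto_zero]
    exact hα
  have hPg : aeval shift P g = 0 := by
    ext n
    rw [hg, aeval_shift_geom, hP, eval_map_algebraMap, minpoly.aeval]
    simp
  have hPa : Tendsto (aeval shift P a) atTop (𝓝 0) := by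
    have h := (tendsto_aeval_shift P he).neg
    rw [map_sub, hPg, zero_sub, neg_zero] at h
    simpa using h
  obtain ⟨N, hN⟩ := eventually_eq_zero_of_tendsto hPa
    (aeval_shift_mem (fun i => by rw [hP, coeff_map]; exact ⟨_, rfl⟩) fun n => ⟨_, rfl⟩)
  set b := aeval shift Q a with hb
  -- `(X - ζ) Q = P` kills `a` from `N` on, so `b` is geometric of ratio `ζ` there.
  have hstep : ∀ n, N ≤ n → b (n + 1) = ζ * b n := by
    intro n hn
    have h := hN n hn
    rw [← hPQ, mul_comm, map_mul, Module.End.mul_apply, ← hb] at h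
    simp only [map_sub, aeval_X, aeval_C, LinearMap.sub_apply, Pi.sub_apply, shift_apply,
      Module.algebraMap_end_apply, Pi.smul_apply, smul_eq_mul] at h
    linarith
  have hgeom : ∀ k, b (N + k) = ζ ^ k * b N := by
    intro k
    induction k with
    | zero => simp
    | succ k ih => rw [← add_assoc, hstep _ (by omega), ih]; ring
  -- `Q` applied to `g - a` is geometric past `N` and tends to 0; since `ζ > 1`, its constant
  -- vanishes.
  have hlim : Tendsto (fun k : ℕ => (α * Q.eval ζ * ζ ^ N - b N) * ζ ^ k) atTop (𝓝 0) := by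
    have h := (tendsto_add_atTop_iff_nat N).2 (tendsto_aeval_shift Q he)
    refine h.congr fun k => ?_
    rw [map_sub, Pi.sub_apply, hg, aeval_shift_geom, ← hb, add_comm k N, hgeom]
    ring
  refine ⟨N, ?_⟩
  have hzero : α * Q.eval ζ * ζ ^ N - b N = 0 := by
    have h2 : Tendsto (fun k : ℕ => (ζ ^ k)⁻¹) atTop (𝓝 0) :=
      (tendsto_pow_atTop_atTop_of_one_lt h1).inv_tendsto_atTop
    have h3 := hlim.mul h2
    rw [mul_zero] at h3
    refine tendsto_nhds_unique (tendsto_const_nhds.congr fun k => ?_) h3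
    rw [mul_inv_cancel_right₀ (by positivity)]
  -- `Q(ζ) = P'(ζ)`, and `b N` is a combination of integers with coefficients of `Q`, which lie in
  -- `ℤ[ζ]`.
  rw [← eval_minpolyDiv_self, ← hQ, sub_eq_zero.1 hzero]
  exact aeval_shift_mem (A := (Algebra.adjoin ℤ {ζ}).toSubring)
    (fun i => coeff_minpolyDiv_mem_adjoin ζ i) (fun n => intCast_mem _ _) N

lemma aeval_derivative_minpoly_int_ne_zero {ζ : ℝ} (hζ : IsIntegral ℤ ζ) :
    aeval ζ (derivative (minpoly ℤ ζ)) ≠ 0 := by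
  have h := (minpoly.irreducible (hζ.tower_top (A := ℚ))).separable.aeval_derivative_ne_zero
    (minpoly.aeval ℚ ζ)
  rwa [minpoly.isIntegrallyClosed_eq_field_fractions' ℚ hζ, derivative_map,
    aeval_map_algebraMap] at h

/-! ### Traces and the lower bound on `M ζ` -/

lemma distInt_nonneg (x : ℝ) : 0 ≤ distInt x := abs_nonneg _

lemma distInt_le (x : ℝ) (m : ℤ) : distInt x ≤ |x - m| := round_le x m

/-- If `α ζ ∈ M ζ` then `α ∈ M ζ`. -/
lemma mem_M_of_mul_mem {α ζ : ℝ} (h : α * ζ ∈ M ζ) : α ∈ M ζ := by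
  refine (tendsto_add_atTop_iff_nat 1).1 (Tendsto.congr (fun n => ?_) h)
  rw [pow_succ']
  ring_nf

/-- For a Pisot number `ζ` the algebraic integers of `ℚ(ζ)` belong to `M ζ`. -/
theorem mem_M_of_isIntegral {ζ α : ℝ} (hζ : IsPisot ζ) (hα : IsIntegral ℤ α)
    (hαζ : α ∈ IntermediateField.adjoin ℚ {ζ}) : α ∈ M ζ := by
  classical
  obtain ⟨hint, -, hconj⟩ := hζ
  set L := IntermediateField.adjoin ℚ {ζ} with hL
  have : FiniteDimensional ℚ L :=
    IntermediateField.adjoin.finiteDimensional (hint.tower_top (A := ℚ))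
  let z : L := ⟨ζ, IntermediateField.mem_adjoin_simple_self ℚ ζ⟩
  let a : L := ⟨α, hαζ⟩
  let ι : L →ₐ[ℚ] ℂ := (Complex.ofRealAm.restrictScalars ℚ).comp L.val
  have hz : IsIntegral ℤ z := (isIntegral_algHom_iff (L.val.restrictScalars ℤ)
    Subtype.val_injective).1 hint
  have ha : IsIntegral ℤ a := (isIntegral_algHom_iff (L.val.restrictScalars ℤ)
    Subtype.val_injective).1 hα
  have htr : ∀ n, ∃ m : ℤ, (m : ℚ) = Algebra.trace ℚ L (a * z ^ n) := fun n =>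
    IsIntegrallyClosed.isIntegral_iff.1 (Algebra.isIntegral_trace (ha.mul (hz.pow n)))
  choose m hm using htr
  have hnorm : ∀ σ : L →ₐ[ℚ] ℂ, σ ≠ ι → ‖σ z‖ < 1 := by
    intro σ hσ
    refine hconj _ ?_ fun h => hσ ?_
    · have : minpoly ℚ ζ = minpoly ℚ z := minpoly.algHom_eq L.val Subtype.val_injective z
      rw [this, aeval_algHom_apply, minpoly.aeval, map_zero]
    · refine IntermediateField.algHom_ext_of_eq_adjoin ℚ hL fun x hx => ?_
      obtain rfl := Set.mem_singleton_iff.1 hx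
      exact h
  have hsum : ∀ n, ((α * ζ ^ n - m n : ℝ) : ℂ) =
      -∑ σ ∈ Finset.univ.erase ι, σ a * (σ z) ^ n := by
    intro n
    have h := trace_eq_sum_embeddings ℂ (K := ℚ) (x := a * z ^ n)
    rw [← hm, ← Finset.add_sum_erase _ _ (Finset.mem_univ ι)] at h
    have hι : ι (a * z ^ n) = ((α * ζ ^ n : ℝ) : ℂ) := rfl
    simp only [map_mul, map_pow] at h hι
    rw [hι] at h
    push_cast at h ⊢
    simp only [map_intCast] at h
    rw [h]
    ring
  have hlim : Tendsto (fun n => -∑ σ ∈ Finset.univ.erase ι, σ a * (σ z) ^ n) atTop (𝓝 0) := by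
    have h : Tendsto (fun n => -∑ σ ∈ Finset.univ.erase ι, σ a * (σ z) ^ n) atTop
        (𝓝 (-∑ σ ∈ Finset.univ.erase ι, σ a * 0)) :=
      (tendsto_finsetSum _ fun σ hσ => (tendsto_pow_atTop_nhds_zero_of_norm_lt_one
        (hnorm σ (Finset.ne_of_mem_erase hσ))).const_mul _).neg
    simpa using h
  refine squeeze_zero (fun n => distInt_nonneg _) (fun n => ?_)
    (tendsto_zero_iff_norm_tendsto_zero.1 hlim)
  rw [← hsum, Complex.norm_real]
  exact distInt_le _ _

/-! ### Pisot generators from Minkowski's theorem -/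

open NumberField NumberField.InfinitePlace NumberField.mixedEmbedding in
/-- A consequence of Minkowski's theorem: some nonzero algebraic integer is arbitrarily small at all
infinite places but one. -/
lemma exists_ringOfIntegers_lt_of_ne (K : Type*) [Field K] [NumberField K] (w₀ : InfinitePlace K)
    {ε : NNReal} (hε : ε ≠ 0) : ∃ a : 𝓞 K, a ≠ 0 ∧ ∀ w, w ≠ w₀ → w a < ε := by
  classical
  obtain ⟨B, hB⟩ : ∃ B : NNReal,
      minkowskiBound K (1 : (FractionalIdeal (nonZeroDivisors (𝓞 K)) K)ˣ) <
        convexBodyLTFactor K * B := by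
    obtain ⟨n, hn⟩ := ENNReal.exists_nat_mul_gt
      (ENNReal.coe_ne_zero.2 (convexBodyLTFactor_ne_zero K)) (minkowskiBound_lt_top K 1).ne
    exact ⟨n, by simpa [mul_comm] using hn⟩
  -- The bound at `w₀` is free, so it is enlarged until the convex body has enough volume.
  obtain ⟨g, hg, hgB⟩ := adjust_f K (f := fun _ => ε) (w₁ := w₀) B fun _ _ => hε
  obtain ⟨a, ha, hlt⟩ := exists_ne_zero_mem_ringOfIntegers_lt K (f := g) (by
    rw [convexBodyLT_volume]
    simpa [← hgB] using hB)
  exact ⟨a, ha, fun w hw => by simpa [hg w hw] using hlt w⟩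

section

variable (K : IntermediateField ℚ ℝ)

/-- The inclusion of a real field in `ℂ`. -/
noncomputable def inclC : K →+* ℂ := Complex.ofRealHom.comp K.val.toRingHom

variable {K}

lemma inclC_apply (x : K) : inclC K x = ((x : ℝ) : ℂ) := rfl

lemma isReal_inclC : NumberField.ComplexEmbedding.IsReal (inclC K) := by
  ext x
  simp [inclC_apply]

variable [FiniteDimensional ℚ K]

instance numberField_of_finiteDimensional : NumberField K where
  to_charZero := inferInstance
  to_finiteDimensional := inferInstance

open NumberField in
/-- An algebraic integer of `K` greater than `1` whose other absolute values are less than `1` is a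
Pisot number generating `K`. -/
lemma mem_pisotGen_of_infinitePlace_lt {x : 𝓞 K} (h1 : 1 < ((x : K) : ℝ))
    (h : ∀ w, w ≠ InfinitePlace.mk (inclC K) → w x < 1) : ((x : K) : ℝ) ∈ pisotGen K := by
  have hx0 : x ≠ 0 := by
    rintro rfl
    simp at h1
    linarith
  refine ⟨⟨x.isIntegral_coe.map (K.val.restrictScalars ℤ), h1, fun z hz hne => ?_⟩, ?_⟩
  · have hmin : minpoly ℚ ((x : K) : ℝ) = minpoly ℚ (x : K) :=
      minpoly.algHom_eq K.val Subtype.val_injective _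
    have hz' : z ∈ (minpoly ℚ (x : K)).rootSet ℂ := by
      rw [mem_rootSet, ← hmin]
      exact ⟨hmin ▸ minpoly.ne_zero (Algebra.IsIntegral.isIntegral _), hz⟩
    rw [← Embeddings.range_eval_eq_rootSet_minpoly] at hz'
    obtain ⟨φ, rfl⟩ := hz'
    refine h (InfinitePlace.mk φ) fun heq => hne ?_
    rcases InfinitePlace.mk_eq_iff.1 heq.symm with h' | h'
    · rw [← h']; rfl
    · rw [show NumberField.ComplexEmbedding.conjugate (inclC K) = inclC K from isReal_inclC] at h'
      rw [← h']; rfl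
  · rw [← IntermediateField.lift_adjoin_simple]
    refine (congrArg IntermediateField.lift ?_).trans (IntermediateField.lift_top ℚ K)
    convert is_primitive_element_of_infinitePlace_lt hx0 h
      (.inl (InfinitePlace.isReal_mk_iff.2 isReal_inclC)) <;> exact Subsingleton.elim _ _

/-- Every real number field is generated by a Pisot number divisible by a given positive integer. -/
theorem exists_natCast_mul_mem_pisotGen (K : IntermediateField ℚ ℝ) [FiniteDimensional ℚ K]
    {d : ℕ} (hd : 0 < d) : ∃ η : ℝ, IsIntegral ℤ η ∧ η ∈ K ∧ d * η ∈ pisotGen K := by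
  have hd' : (1 : ℝ) ≤ d := by exact_mod_cast hd
  have hpos : (0 : ℝ) < 2 * d := by positivity
  let w₀ := NumberField.InfinitePlace.mk (inclC K)
  obtain ⟨a, ha, hlt⟩ := exists_ringOfIntegers_lt_of_ne K w₀ (ε := (2 * d : NNReal)⁻¹)
    (by positivity)
  have hw₀ : (1 : ℝ) ≤ |((a : K) : ℝ)| := by
    -- By the product formula, an integer small at all other places is large at `w₀`.
    have h : 1 ≤ w₀ a := NumberField.InfinitePlace.one_le_of_lt_one ha fun w hw =>
      (hlt w hw).trans_le (by push_cast; exact inv_le_one_of_one_le₀ (by linarith))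
    rwa [NumberField.InfinitePlace.apply, inclC_apply, Complex.norm_real] at h
  obtain ⟨b, hb1, hb⟩ : ∃ b : NumberField.RingOfIntegers K, 1 ≤ ((b : K) : ℝ) ∧
      ∀ w : NumberField.InfinitePlace K, w b = w a := by
    rcases le_total 0 ((a : K) : ℝ) with h | h
    · exact ⟨a, by rwa [abs_of_nonneg h] at hw₀, fun _ => rfl⟩
    · exact ⟨-a, by rw [abs_of_nonpos h] at hw₀; simpa using hw₀, fun w => by
      rw [NumberField.RingOfIntegers.coe_eq_algebraMap, map_neg]
      exact map_neg_eq_map w.1 _⟩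
  -- The factor 2 makes `d * η > 1` strict even if `b = 1`; the choice `ε = 1 / (2 * d)` absorbs it.
  refine ⟨2 * ((b : K) : ℝ), ?_, ?_, ?_⟩
  · exact (isIntegral_natCast 2).mul (b.isIntegral_coe.map (K.val.restrictScalars ℤ))
  · exact mul_mem (ofNat_mem _ 2) (b : K).2
  · let x : NumberField.RingOfIntegers K := ((2 * d : ℕ) : NumberField.RingOfIntegers K) * b
    have hx : (x : K) = ((2 * d : ℕ) : K) * b := by
      rw [NumberField.RingOfIntegers.coe_eq_algebraMap, map_mul, map_natCast]
    have hxR : ((x : K) : ℝ) = d * (2 * ((b : K) : ℝ)) := by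
      have h : (((2 * d : ℕ) : K) : ℝ) = (2 * d : ℕ) := map_natCast K.val _
      rw [hx, MulMemClass.coe_mul, h]
      push_cast
      ring
    rw [← hxR]
    refine mem_pisotGen_of_infinitePlace_lt (by rw [hxR]; nlinarith) fun w hw => ?_
    have h := hlt w hw
    have hnat : w ((2 * d : ℕ) : K) = 2 * d := by
      rw [← NumberField.InfinitePlace.norm_embedding_eq, map_natCast, Complex.norm_natCast]
      push_cast
      rfl
    push_cast at h
    rw [hx, map_mul, hb, hnat]
    calc 2 * (d : ℝ) * w a < 2 * d * (2 * (d : ℝ))⁻¹ := mul_lt_mul_of_pos_left h hpos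
      _ = 1 := mul_inv_cancel₀ hpos.ne'

end

/-! ### Denominators -/

/-- An algebraic number has a positive integer multiple which is an algebraic integer. -/
lemma exists_nat_mul_isIntegral {x : ℝ} (hx : IsAlgebraic ℚ x) :
    ∃ m : ℕ, 0 < m ∧ IsIntegral ℤ (m * x) := by
  obtain ⟨y, hy, hint⟩ :=
    ((IsFractionRing.isAlgebraic_iff ℤ ℚ ℝ).2 hx).exists_integral_multiple
  refine ⟨y.natAbs, Int.natAbs_pos.2 hy, ?_⟩
  rw [zsmul_eq_mul] at hint
  rcases Int.natAbs_eq y with h | h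
  · rw [h] at hint
    simpa only [Int.cast_natCast] using hint
  · rw [h] at hint
    simpa using hint.neg

lemma isPisot_natCast {n : ℕ} (hn : 2 ≤ n) : IsPisot n := by
  refine ⟨isIntegral_natCast _, by exact_mod_cast hn, fun z hz hne => absurd ?_ hne⟩
  have h : minpoly ℚ (n : ℝ) = X - C (n : ℚ) := by
    simpa using minpoly.eq_X_sub_C ℝ (n : ℚ)
  rw [h] at hz
  simpa [sub_eq_zero] using hz

/-- For `ζ = n` the minimal polynomial is `X - n`, so `P' = 1` and `ℤ[ζ] = ℤ`. -/
lemma exists_mul_pow_eq_intCast {n : ℕ} (hn : 2 ≤ n) {α : ℝ} (hα : α ∈ M n) :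
    ∃ (N : ℕ) (k : ℤ), α * (n : ℝ) ^ N = k := by
  obtain ⟨N, hN⟩ := exists_mul_derivative_mul_pow_mem_adjoin (by exact_mod_cast hn) hα
  have h : minpoly ℤ (n : ℝ) = X - C (n : ℤ) := by
    simpa using minpoly.eq_X_sub_C_of_algebraMap_inj (n : ℤ)
      (algebraMap ℤ ℝ).injective_int
  have hbot : Algebra.adjoin ℤ {(n : ℝ)} = ⊥ :=
    le_bot_iff.1 (Algebra.adjoin_le (Set.singleton_subset_iff.2 (natCast_mem _ _)))
  rw [h, hbot] at hN
  obtain ⟨k, hk⟩ := Algebra.mem_bot.1 hN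
  exact ⟨N, k, by simpa using hk.symm⟩

lemma mem_intSet_of_mem_M_two_three {α : ℝ} (h2 : α ∈ M (2 : ℕ)) (h3 : α ∈ M (3 : ℕ)) :
    α ∈ intSet := by
  obtain ⟨a, k, hk⟩ := exists_mul_pow_eq_intCast le_rfl h2
  obtain ⟨b, l, hl⟩ := exists_mul_pow_eq_intCast (by norm_num) h3
  obtain ⟨u, v, huv⟩ : IsCoprime ((2 : ℤ) ^ a) (3 ^ b) :=
    IsCoprime.pow (by norm_num)
  refine ⟨u * k + v * l, ?_⟩
  have huv' : (u : ℝ) * 2 ^ a + v * 3 ^ b = 1 := by exact_mod_cast huv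
  push_cast at hk hl ⊢
  rw [← hk, ← hl]
  linear_combination α * huv'

lemma M_subset_adjoin {ζ : ℝ} (hζ : IsPisot ζ) :
    M ζ ⊆ (IntermediateField.adjoin ℚ {ζ} : Set ℝ) := by
  intro α hα
  obtain ⟨N, hN⟩ := exists_mul_derivative_mul_pow_mem_adjoin hζ.2.1 hα
  set F := IntermediateField.adjoin ℚ {ζ}
  have hmem : ζ ∈ F := IntermediateField.mem_adjoin_simple_self ℚ ζ
  have hle : Algebra.adjoin ℤ {ζ} ≤ F.toSubalgebra.restrictScalars ℤ :=
    Algebra.adjoin_le (by simpa using hmem)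
  have hc : aeval ζ (derivative (minpoly ℤ ζ)) ∈ F :=
    hle (aeval_mem_adjoin_singleton ℤ ζ)
  have h0 := aeval_derivative_minpoly_int_ne_zero hζ.1
  have hζ0 : ζ ≠ 0 := (zero_lt_one.trans hζ.2.1).ne'
  have h : α = α * aeval ζ (derivative (minpoly ℤ ζ)) * ζ ^ N /
      (aeval ζ (derivative (minpoly ℤ ζ)) * ζ ^ N) := by
    field_simp
  rw [h]
  exact div_mem (hle hN) (mul_mem hc (pow_mem hmem N))

/-- For a Pisot number `ζ`, some rational number lies outside `M ζ`. -/
lemma exists_rat_notMem_M {ζ : ℝ} (hζ : IsPisot ζ) : ∃ q : ℚ, (q : ℝ) ∉ M ζ := by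
  set c := aeval ζ (derivative (minpoly ℤ ζ)) with hc
  have h0 : c ≠ 0 := aeval_derivative_minpoly_int_ne_zero hζ.1
  have hζ0 : ζ ≠ 0 := (zero_lt_one.trans hζ.2.1).ne'
  have hle : Algebra.adjoin ℤ {ζ} ≤ integralClosure ℤ ℝ :=
    Algebra.adjoin_le (Set.singleton_subset_iff.2 hζ.1)
  have hcint : IsIntegral ℤ c := hle (aeval_mem_adjoin_singleton ℤ ζ)
  obtain ⟨m, hm, hmc⟩ := exists_nat_mul_isIntegral
    (hcint.tower_top (A := ℚ)).isAlgebraic.inv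
  obtain ⟨l, hl, hlz⟩ := exists_nat_mul_isIntegral
    (hζ.1.tower_top (A := ℚ)).isAlgebraic.inv
  -- `m` and `l` clear the denominators of `c⁻¹` and `ζ⁻¹`, and `m * l + 1` is coprime to `m * l ^
  -- N` for every `N`.
  refine ⟨1 / (m * l + 1 : ℕ), fun hmem => ?_⟩
  obtain ⟨N, hN⟩ := exists_mul_derivative_mul_pow_mem_adjoin hζ.2.1 hmem
  have hint : IsIntegral ℤ (((m * l ^ N / (m * l + 1 : ℕ) : ℚ) : ℝ)) := by
    have h := (show IsIntegral ℤ _ from hle hN).mul (hmc.mul (hlz.pow N))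
    rw [← hc] at h
    refine (congrArg (IsIntegral ℤ) ?_).mp h
    push_cast
    rw [mul_pow, inv_pow]
    field_simp
  have hint' : IsIntegral ℤ (m * l ^ N / (m * l + 1 : ℕ) : ℚ) :=
    (isIntegral_algebraMap_iff (algebraMap ℚ ℝ).injective).1 hint
  obtain ⟨k, hk⟩ := IsIntegrallyClosed.isIntegral_iff.1 hint'
  have hdvd : ((m * l + 1 : ℕ) : ℤ) ∣ m * l ^ N := by
    refine ⟨k, ?_⟩
    rw [eq_intCast, eq_div_iff (by positivity)] at hk
    rw [mul_comm _ k]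
    exact_mod_cast hk.symm
  have hdvd' : m * l + 1 ∣ m * l ^ N := by exact_mod_cast hdvd
  have hcop : Nat.Coprime (m * l + 1) (m * l ^ N) := by
    refine Nat.Coprime.mul_right ?_ (Nat.Coprime.pow_right N ?_)
    · simp
    · simp
  have := Nat.Coprime.eq_one_of_dvd hcop hdvd'
  have : 0 < m * l := by positivity
  omega

/-! ### The inclusions of the theorem -/

lemma pisotGen_subset_pisotIn (K : IntermediateField ℚ ℝ) : pisotGen K ⊆ pisotIn K := by
  rintro ζ ⟨h, rfl⟩
  exact ⟨h, IntermediateField.mem_adjoin_simple_self ℚ ζ⟩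

lemma mem_ringOfIntegersSet {K : IntermediateField ℚ ℝ} {x : ℝ} :
    x ∈ ringOfIntegersSet K ↔ x ∈ K ∧ IsIntegral ℤ x := by
  constructor
  · rintro ⟨y, rfl⟩
    exact ⟨(y : K).2, y.isIntegral_coe.map (K.val.restrictScalars ℤ)⟩
  · rintro ⟨hx, hint⟩
    exact ⟨⟨⟨x, hx⟩, (isIntegral_algHom_iff (K.val.restrictScalars ℤ)
      Subtype.val_injective).1 hint⟩, rfl⟩

lemma ringOfIntegersSet_subset_M {K : IntermediateField ℚ ℝ} {ζ : ℝ} (hζ : ζ ∈ pisotGen K) :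
    ringOfIntegersSet K ⊆ M ζ := by
  obtain ⟨h, rfl⟩ := hζ
  intro x hx
  rw [mem_ringOfIntegersSet] at hx
  exact mem_M_of_isIntegral h hx.2 hx.1

theorem iInter_pisotIn_M (K : IntermediateField ℚ ℝ) : ⋂ ζ ∈ pisotIn K, M ζ = intSet := by
  refine Set.Subset.antisymm (fun α hα => ?_) (Set.subset_iInter₂ fun ζ hζ => ?_)
  · rw [Set.mem_iInter₂] at hα
    exact mem_intSet_of_mem_M_two_three
      (hα _ ⟨isPisot_natCast le_rfl, natCast_mem _ _⟩)
      (hα _ ⟨isPisot_natCast (by norm_num), natCast_mem _ _⟩)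
  · rintro _ ⟨m, rfl⟩
    exact mem_M_of_isIntegral hζ.1 (isIntegral_intCast _) (intCast_mem _ _)

theorem intSet_ssubset_ringOfIntegersSet (K : IntermediateField ℚ ℝ) [FiniteDimensional ℚ K]
    (hK : K ≠ ⊥) : intSet ⊂ ringOfIntegersSet K := by
  rw [Set.ssubset_iff_exists]
  constructor
  · rintro _ ⟨m, rfl⟩
    exact mem_ringOfIntegersSet.2 ⟨intCast_mem _ _, isIntegral_intCast _⟩
  obtain ⟨x, hx, hxQ⟩ := SetLike.exists_of_lt (bot_lt_iff_ne_bot.2 hK)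
  obtain ⟨m, hm, hint⟩ := exists_nat_mul_isIntegral
    ((Algebra.IsAlgebraic.isAlgebraic (R := ℚ) (⟨x, hx⟩ : K)).algebraMap (A := ℝ))
  refine ⟨m * x, mem_ringOfIntegersSet.2 ⟨mul_mem (natCast_mem _ _) hx, hint⟩, ?_⟩
  rintro ⟨k, hk⟩
  refine hxQ (IntermediateField.mem_bot.2 ⟨k / m, ?_⟩)
  have : (m : ℝ) ≠ 0 := by positivity
  simp only [eq_ratCast]
  push_cast
  rw [hk]
  field_simp

theorem subset_iUnion_pisotGen_M (K : IntermediateField ℚ ℝ) [FiniteDimensional ℚ K] :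
    (K : Set ℝ) ⊆ ⋃ ζ ∈ pisotGen K, M ζ := by
  intro x hx
  obtain ⟨m, hm, hint⟩ := exists_nat_mul_isIntegral
    ((Algebra.IsAlgebraic.isAlgebraic (R := ℚ) (⟨x, hx⟩ : K)).algebraMap (A := ℝ))
  -- The generator `m * η` makes `x * (m * η)` integral.
  obtain ⟨η, hη, hηK, hmem⟩ := exists_natCast_mul_mem_pisotGen K hm
  refine Set.mem_iUnion₂.2 ⟨_, hmem, mem_M_of_mul_mem (ringOfIntegersSet_subset_M hmem ?_)⟩
  refine mem_ringOfIntegersSet.2 ⟨mul_mem hx (mul_mem (natCast_mem _ _) hηK), ?_⟩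
  have h := hint.mul hη
  refine (congrArg (IsIntegral ℤ) ?_).mp h
  change m * x * η = x * (m * η)
  ring

theorem iUnion_pisotIn_M_subset (K : IntermediateField ℚ ℝ) :
    ⋃ ζ ∈ pisotIn K, M ζ ⊆ (K : Set ℝ) :=
  Set.iUnion₂_subset fun _ hζ => (M_subset_adjoin hζ.1).trans
    (IntermediateField.adjoin_simple_le_iff.2 hζ.2)

end PisotModules

theorem mainTheorem5 (K : IntermediateField ℚ ℝ) [FiniteDimensional ℚ K] (hK : K ≠ ⊥) :
    (⋂ ζ ∈ PisotModules.pisotIn K, PisotModules.M ζ) = PisotModules.intSet ∧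
    PisotModules.intSet ⊂ PisotModules.ringOfIntegersSet K ∧
    PisotModules.ringOfIntegersSet K ⊆ (⋂ ζ ∈ PisotModules.pisotGen K, PisotModules.M ζ) ∧
    (⋂ ζ ∈ PisotModules.pisotGen K, PisotModules.M ζ) ⊂
      (⋃ ζ ∈ PisotModules.pisotGen K, PisotModules.M ζ) ∧
    (⋃ ζ ∈ PisotModules.pisotGen K, PisotModules.M ζ) =
      (⋃ ζ ∈ PisotModules.pisotIn K, PisotModules.M ζ) ∧
    (⋃ ζ ∈ PisotModules.pisotIn K, PisotModules.M ζ) = (K : Set ℝ) := by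
  have hsub : ⋃ ζ ∈ PisotModules.pisotGen K, PisotModules.M ζ ⊆
      ⋃ ζ ∈ PisotModules.pisotIn K, PisotModules.M ζ :=
    Set.biUnion_subset_biUnion_left (PisotModules.pisotGen_subset_pisotIn K)
  have hIn := PisotModules.iUnion_pisotIn_M_subset K
  have hGen := PisotModules.subset_iUnion_pisotGen_M K
  -- With `d = 1` this just says that `pisotGen K` is nonempty.
  obtain ⟨η, -, -, hζ⟩ := PisotModules.exists_natCast_mul_mem_pisotGen K one_pos
  obtain ⟨q, hq⟩ := PisotModules.exists_rat_notMem_M hζ.1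
  refine ⟨PisotModules.iInter_pisotIn_M K, PisotModules.intSet_ssubset_ringOfIntegersSet K hK,
    Set.subset_iInter₂ fun ζ h => PisotModules.ringOfIntegersSet_subset_M h,
    Set.ssubset_iff_exists.2 ⟨?_, q, hGen (SubfieldClass.ratCast_mem K q), ?_⟩,
    hsub.antisymm (hIn.trans hGen), hIn.antisymm (hGen.trans hsub)⟩
  · exact (Set.biInter_subset_of_mem hζ).trans (Set.subset_biUnion_of_mem hζ)
  · exact fun h => hq (Set.mem_iInter₂.1 h _ hζ)
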